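/- Let $m\ge 1$, let $\Sigma_{TOA},\Sigma_{RSS},\Sigma_{AOA}\in\mathbb R^{m\times m}$ be symmetric positive definite, $\eta\in\mathbb R$, $d_1,\dots,d_m>0$, $D=\mathrm{diag}(1/d_1,\dots,1/d_m)$, $U=\begin{bmatrix}0&1\\-1&0\end{bmatrix}$, $R_1=\Sigma_{TOA}^{-1}+\eta^2D\Sigma_{RSS}^{-1}D$, $R_2=D\Sigma_{AOA}^{-1}D$, $R=\mathrm{blkdiag}(R_1,R_2)$. Let $J\in\mathbb R^{m\times 2}$ (the current primal iterate) have rows of Euclidean norm one, and let $H=\begin{bmatrix}J\\JU\end{bmatrix}$. Let $a_i\in\mathbb R^4$ be the $i$-th column of $\begin{bmatrix}J^TR_1\\J^TR_2\end{bmatrix}$, and for a $2\times2$ matrix $\Phi$ put $\tilde\Phi=[\Phi,\;U\Phi U^T]$. The dual problem is to minimize $$h(\Phi)=2\sum_{i=1}^m\|\tilde\Phi a_i\|-\mathrm{Tr}(H^TRH\Phi)-\mathrm{Tr}(\sqrt\Phi)\quad\text{over symmetric }\Phi\succeq0 .$$ Given $\Psi\succeq0$ with $\|\tilde\Psi a_i\|\ne0$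 for all $i$, put $A=\sum_i a_ia_i^T/\|\tilde\Psi a_i\|$, $\lambda_1=\lambda_{\max}(A)$, $\tilde A=A-\lambda_1I$, $[B_1,B_2]=\tilde\Psi\tilde A$ (with $B_1,B_2\in\mathbb R^{2\times2}$), $C=B_1+B_1^T+U^T(B_2+B_2^T)U-H^TRH$, $\lambda=2\lambda_1$, and $$g(\Phi|\Psi)=-\mathrm{Tr}(\tilde\Psi\tilde A\tilde\Psi^T)+2\mathrm{Tr}(\tilde\Psi\tilde A\tilde\Phi^T)+\lambda_1\mathrm{Tr}(\tilde\Phi^T\tilde\Phi)-\mathrm{Tr}(H^TRH\Phi)-\mathrm{Tr}(\sqrt\Phi)+\sum_i\|\tilde\Psi a_i\| .$$ An MM update of $\Psi$ is a matrix $VXV^T$, where $C=VEV^T$ is an eigendecomposition ($V$ orthogonal, $E$ diagonal) and $X$ is diagonal with $X_{ii}=x_i^2$, $x_i$ being a positive real root of $4\lambda x^3+2E_{ii}x-1=0$. (1) For every such $\Psi$: $h(\Phi)\le g(\Phi|\Psi)$ for all $\Phi\succeq0$, with equality at $\Phi=\Psi$; an MM update of $\Psi$ exists; and every MM update of $\Psi$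 is positive semidefinite and minimizes $g(\cdot|\Psi)$ over $\Phi\succeq0$. (2) Let $\Phi_0\succeq0$ and, for every $k\ge0$, let $\Phi_{k+1}$ be an MM update of $\Phi_k$. Assume that the majorizer is nondegenerate along the iteration, i.e. $\|\tilde\Phi a_i\|\ne0$ for all $i$ whenever $\Phi$ is one of the iterates $\Phi_k$ or a positive definite accumulation point of the sequence $(\Phi_k)$. Then $(\Phi_k)$ converges to a matrix $\Phi^\star\succeq0$ that is a global minimizer of $h$ over $\Phi\succeq0$, and $h(\Phi_k)\to h(\Phi^\star)=\min_{\Phi\succeq0}h(\Phi)$. -/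

import Mathlib

namespace SensorPlacement

open Matrix

noncomputable section

/-- The planar rotation `U`. -/
def U : Matrix (Fin 2) (Fin 2) ℝ := !![0, 1; -1, 0]

/-- The distance matrix `D = diag (1/d₁, …, 1/dₘ)`. -/
def distMat {m : ℕ} (d : Fin m → ℝ) : Matrix (Fin m) (Fin m) ℝ :=
  diagonal fun i => 1 / d i

/-- `R₁ = Σ_TOA⁻¹ + η² D Σ_RSS⁻¹ D`. -/
def R₁ {m : ℕ} (Stoa Srss : Matrix (Fin m) (Fin m) ℝ) (η : ℝ) (d : Fin m → ℝ) :
    Matrix (Fin m) (Fin m) ℝ :=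
  Stoa⁻¹ + η ^ 2 • (distMat d * Srss⁻¹ * distMat d)

/-- `R₂ = D Σ_AOA⁻¹ D`. -/
def R₂ {m : ℕ} (Saoa : Matrix (Fin m) (Fin m) ℝ) (d : Fin m → ℝ) :
    Matrix (Fin m) (Fin m) ℝ :=
  distMat d * Saoa⁻¹ * distMat d

/-- The orientation matrices: every row has Euclidean norm one. -/
def IsOrientation {m : ℕ} (J : Matrix (Fin m) (Fin 2) ℝ) : Prop :=
  ∀ i, J i ⬝ᵥ J i = 1

/-- `H = [J; J U]`. -/
def Hmat {m : ℕ} (J : Matrix (Fin m) (Fin 2) ℝ) : Matrix (Fin m ⊕ Fin m) (Fin 2) ℝ :=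
  fromRows J (J * U)

/-- `Hᵀ R H` with `R = blkdiag (R₁, R₂)`. -/
def HRH {m : ℕ} (R₁ R₂ : Matrix (Fin m) (Fin m) ℝ) (J : Matrix (Fin m) (Fin 2) ℝ) :
    Matrix (Fin 2) (Fin 2) ℝ :=
  (Hmat J)ᵀ * fromBlocks R₁ 0 0 R₂ * Hmat J

/-- `aᵢ`: the `i`-th column of `Jᵀ R₁` stacked on the `i`-th column of `Jᵀ R₂`. -/
def avec {m : ℕ} (R₁ R₂ : Matrix (Fin m) (Fin m) ℝ) (J : Matrix (Fin m) (Fin 2) ℝ)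
    (i : Fin m) : Fin 2 ⊕ Fin 2 → ℝ :=
  Sum.elim (fun r => (Jᵀ * R₁) r i) (fun r => (Jᵀ * R₂) r i)

/-- `Φ̃ = [Φ, Q]` with `Q = U Φ Uᵀ`. -/
def tilde (Φ : Matrix (Fin 2) (Fin 2) ℝ) : Matrix (Fin 2) (Fin 2 ⊕ Fin 2) ℝ :=
  fromCols Φ (U * Φ * Uᵀ)

/-- The Euclidean norm `‖Φ̃ aᵢ‖`. -/
def nrm {m : ℕ} (R₁ R₂ : Matrix (Fin m) (Fin m) ℝ) (J : Matrix (Fin m) (Fin 2) ℝ)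
    (Φ : Matrix (Fin 2) (Fin 2) ℝ) (i : Fin m) : ℝ :=
  ‖WithLp.toLp 2 (tilde Φ *ᵥ avec R₁ R₂ J i)‖

/-- `Tr √Φ`; for positive semidefinite `Φ` the functional calculus gives the positive
semidefinite square root. -/
def trSqrt (Φ : Matrix (Fin 2) (Fin 2) ℝ) : ℝ := (cfc Real.sqrt Φ).trace

/-- The dual objective `h (Φ) = 2 ∑ ‖Φ̃ aᵢ‖ - Tr (Hᵀ R H Φ) - Tr √Φ`. -/
def h {m : ℕ} (R₁ R₂ : Matrix (Fin m) (Fin m) ℝ) (J : Matrix (Fin m) (Fin 2) ℝ)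
    (Φ : Matrix (Fin 2) (Fin 2) ℝ) : ℝ :=
  2 * ∑ i, nrm R₁ R₂ J Φ i - (HRH R₁ R₂ J * Φ).trace - trSqrt Φ

/-- The feasible set `Φ ⪰ 0`. -/
def psd : Set (Matrix (Fin 2) (Fin 2) ℝ) := {Φ | Φ.PosSemidef}

/-- `A = ∑ aᵢ aᵢᵀ / ‖Φ̃ₖ aᵢ‖` at the current point `Φₖ`. -/
def Amat {m : ℕ} (R₁ R₂ : Matrix (Fin m) (Fin m) ℝ) (J : Matrix (Fin m) (Fin 2) ℝ)
    (Φk : Matrix (Fin 2) (Fin 2) ℝ) : Matrix (Fin 2 ⊕ Fin 2) (Fin 2 ⊕ Fin 2) ℝ :=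
  ∑ i, (1 / nrm R₁ R₂ J Φk i) • vecMulVec (avec R₁ R₂ J i) (avec R₁ R₂ J i)

/-- `λ₁ = λ_max (A)`. -/
def lam₁ {m : ℕ} (R₁ R₂ : Matrix (Fin m) (Fin m) ℝ) (J : Matrix (Fin m) (Fin 2) ℝ)
    (Φk : Matrix (Fin 2) (Fin 2) ℝ) : ℝ :=
  sSup (spectrum ℝ (Amat R₁ R₂ J Φk))

/-- The shifted matrix `Ã = A - λ₁ I`. -/
def Ashift {m : ℕ} (R₁ R₂ : Matrix (Fin m) (Fin m) ℝ) (J : Matrix (Fin m) (Fin 2) ℝ)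
    (Φk : Matrix (Fin 2) (Fin 2) ℝ) : Matrix (Fin 2 ⊕ Fin 2) (Fin 2 ⊕ Fin 2) ℝ :=
  Amat R₁ R₂ J Φk - lam₁ R₁ R₂ J Φk • (1 : Matrix (Fin 2 ⊕ Fin 2) (Fin 2 ⊕ Fin 2) ℝ)

/-- The surrogate `g_h (Φ | Φₖ)`: the norms are majorized by quadratics and the concave part
`Tr (Φ̃ Ã Φ̃ᵀ)` is linearized at `Φₖ`. The last term collects the additive constants
`‖Φ̃ₖ aᵢ‖ / 2` of the norm majorizers. -/
def surrogate {m : ℕ} (R₁ R₂ : Matrix (Fin m) (Fin m) ℝ) (J : Matrix (Fin m) (Fin 2) ℝ)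
    (Φk Φ : Matrix (Fin 2) (Fin 2) ℝ) : ℝ :=
  -(tilde Φk * Ashift R₁ R₂ J Φk * (tilde Φk)ᵀ).trace
    + 2 * (tilde Φk * Ashift R₁ R₂ J Φk * (tilde Φ)ᵀ).trace
    + lam₁ R₁ R₂ J Φk * ((tilde Φ)ᵀ * tilde Φ).trace
    - (HRH R₁ R₂ J * Φ).trace - trSqrt Φ + ∑ i, nrm R₁ R₂ J Φk i

/-- `B = [B₁, B₂] = Φ̃ₖ Ã`. -/
def Bmat {m : ℕ} (R₁ R₂ : Matrix (Fin m) (Fin m) ℝ) (J : Matrix (Fin m) (Fin 2) ℝ)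
    (Φk : Matrix (Fin 2) (Fin 2) ℝ) : Matrix (Fin 2) (Fin 2 ⊕ Fin 2) ℝ :=
  tilde Φk * Ashift R₁ R₂ J Φk

/-- `C = B₁ + B₁ᵀ + Uᵀ (B₂ + B₂ᵀ) U - Hᵀ R H`. -/
def Cmat {m : ℕ} (R₁ R₂ : Matrix (Fin m) (Fin m) ℝ) (J : Matrix (Fin m) (Fin 2) ℝ)
    (Φk : Matrix (Fin 2) (Fin 2) ℝ) : Matrix (Fin 2) (Fin 2) ℝ :=
  (Bmat R₁ R₂ J Φk).toCols₁ + (Bmat R₁ R₂ J Φk).toCols₁ᵀ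
    + Uᵀ * ((Bmat R₁ R₂ J Φk).toCols₂ + (Bmat R₁ R₂ J Φk).toCols₂ᵀ) * U - HRH R₁ R₂ J

/-- One step of the inner loop: for an eigendecomposition `C = V E Vᵀ` and the positive
real roots `xᵢ` of `4 λ x³ + 2 Eᵢ x - 1 = 0`, `λ = 2 λ₁`, the next iterate is
`V X Vᵀ` with `Xᵢᵢ = xᵢ²`. -/
def IsUpdate {m : ℕ} (R₁ R₂ : Matrix (Fin m) (Fin m) ℝ) (J : Matrix (Fin m) (Fin 2) ℝ)
    (Φk Φnext : Matrix (Fin 2) (Fin 2) ℝ) : Prop :=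
  ∃ V ∈ orthogonalGroup (Fin 2) ℝ, ∃ E x : Fin 2 → ℝ,
    Cmat R₁ R₂ J Φk = V * diagonal E * Vᵀ ∧
    (∀ i, 0 < x i ∧ 4 * (2 * lam₁ R₁ R₂ J Φk) * x i ^ 3 + 2 * E i * x i - 1 = 0) ∧
    Φnext = V * diagonal (fun i => x i ^ 2) * Vᵀ

/-- The proviso of the norm majorizer at `Φ`: no `‖Φ̃ aᵢ‖` vanishes. -/
def Nonvanishing {m : ℕ} (R₁ R₂ : Matrix (Fin m) (Fin m) ℝ) (J : Matrix (Fin m) (Fin 2) ℝ)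
    (Φ : Matrix (Fin 2) (Fin 2) ℝ) : Prop :=
  ∀ i, nrm R₁ R₂ J Φ i ≠ 0

end

end SensorPlacement

/-! The objective is convex: a sum of norms, a linear term and the convex function `-Tr √Φ`.
Derivatives of the square root are avoided by the tangent bound `trSqrt_le_tangent`, which comes
from `Tr ((T - S) S⁻¹ (T - S)) ≥ 0` with `T = √X` and is tight only at `X = S * S`.

Regrouped, the surrogate is the linearization of the norms plus the proximal term `2 λ₁ ‖X - Ψ‖²`
(Frobenius norm), the trace terms being kept. Majorization follows from `2 p q ≤ p² + q²` and `A ⪯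
λ₁ I`. Dividing the cubic by `x` turns an update into a stationarity equation with `S⁻¹ / 2` as
gradient, `Ψ' = S * S`. Hence `surrogate_sub_surrogate`: the excess of the surrogate over its value
at `Ψ'` is a squared distance plus a tangent gap, both nonnegative.

For convergence, the values decrease and `h` is coercive, so the iterates are bounded. Testing
stationarity on eigenvectors keeps the spectrum of all iterates after the initial one above a fixed
positive threshold, so cluster points are positive definite. Convexity and stationarity give
`IsUpdate.sub_le_h`, bounding `h X` below by `h Ψ` up to errors controlled by the decrease of `h`,
which tends to zero. Every cluster point is thus a global minimizer. By strict concavity of `Tr √Φ`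
there is only one, and compactness gives convergence of the whole sequence. -/

namespace SensorPlacement

open Matrix Filter Topology

/-! ### Trace of the square root and its tangents -/

section SquareRoot

variable {Φ S T X : Matrix (Fin 2) (Fin 2) ℝ}

open scoped MatrixOrder in
lemma exists_posSemidef_sqrt (hΦ : Φ.PosSemidef) :
    ∃ T : Matrix (Fin 2) (Fin 2) ℝ, T.PosSemidef ∧ T * T = Φ ∧ trSqrt Φ = T.trace := by
  refine ⟨cfc Real.sqrt Φ, ?_, ?_, rfl⟩
  · rw [← nonneg_iff_posSemidef]
    exact cfc_nonneg fun x _ => Real.sqrt_nonneg x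
  · have hsa : IsSelfAdjoint Φ := hΦ.isHermitian
    rw [← cfc_mul Real.sqrt Real.sqrt Φ]
    conv_rhs => rw [← cfc_id ℝ Φ]
    refine cfc_congr fun x hx => ?_
    exact Real.mul_self_sqrt ((posSemidef_iff_isHermitian_and_spectrum_nonneg.1 hΦ).2 hx)

lemma trSqrt_mul_self (hT : T.PosSemidef) : trSqrt (T * T) = T.trace := by
  have hsa : IsSelfAdjoint T := hT.isHermitian
  have h1 : cfc (fun x : ℝ => x ^ 2) T = T * T := by
    rw [cfc_pow_id (R := ℝ) T 2, pow_two]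
  have h2 : cfc Real.sqrt (T * T) = T := by
    rw [← h1, ← cfc_comp' Real.sqrt (fun x : ℝ => x ^ 2) T]
    conv_rhs => rw [← cfc_id ℝ T]
    refine cfc_congr fun x hx => ?_
    exact Real.sqrt_sq ((posSemidef_iff_isHermitian_and_spectrum_nonneg.1 hT).2 hx)
  rw [trSqrt, h2]

lemma trace_sub_mul_inv_mul_sub (hS : S.PosDef) (T : Matrix (Fin 2) (Fin 2) ℝ) :
    ((T - S) * S⁻¹ * (T - S)).trace = (S⁻¹ * (T * T)).trace - 2 * T.trace + S.trace := by
  have hu : IsUnit S.det := (isUnit_iff_isUnit_det S).1 hS.isUnit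
  have h1 : (T - S) * S⁻¹ * (T - S) = T * S⁻¹ * T - T - T + S := by
    have e1 : S * S⁻¹ = 1 := mul_nonsing_inv S hu
    have e2 : T * S⁻¹ * S = T := nonsing_inv_mul_cancel_right S T hu
    rw [sub_mul, e1, mul_sub, sub_mul, sub_mul, e2, one_mul, one_mul]
    abel
  have h2 : (T * S⁻¹ * T).trace = (S⁻¹ * (T * T)).trace := by
    rw [mul_assoc, trace_mul_comm, mul_assoc]
  rw [h1, trace_add, trace_sub, trace_sub, h2]
  ring

lemma posSemidef_sub_mul_inv_mul_sub (hS : S.PosDef) (hT : T.PosSemidef) :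
    ((T - S) * S⁻¹ * (T - S)).PosSemidef := by
  have := hS.inv.posSemidef.conjTranspose_mul_mul_same (T - S)
  rwa [(hT.isHermitian.sub hS.isHermitian).eq] at this

lemma trSqrt_le_tangent (hS : S.PosDef) (hX : X.PosSemidef) :
    trSqrt X ≤ S.trace / 2 + (S⁻¹ * X).trace / 2 := by
  obtain ⟨T, hT, rfl, h⟩ := exists_posSemidef_sqrt hX
  have h1 := trace_sub_mul_inv_mul_sub hS T
  have h2 := (posSemidef_sub_mul_inv_mul_sub hS hT).trace_nonneg
  linarith

/-- Equality kills the trace of a positive semidefinite matrix, hence the matrix, and definiteness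
of `S⁻¹` then forces `T = S`. This is the strict concavity behind uniqueness of the minimizer. -/
lemma eq_mul_self_of_trSqrt_eq_tangent (hS : S.PosDef) (hX : X.PosSemidef)
    (heq : trSqrt X = S.trace / 2 + (S⁻¹ * X).trace / 2) : X = S * S := by
  obtain ⟨T, hT, rfl, h⟩ := exists_posSemidef_sqrt hX
  have h1 := trace_sub_mul_inv_mul_sub hS T
  have h2 : ((T - S) * S⁻¹ * (T - S)).trace = 0 := by linarith
  rw [(posSemidef_sub_mul_inv_mul_sub hS hT).trace_eq_zero_iff] at h2
  have h3 : T - S = 0 := by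
    ext i j
    have hsym : (T - S)ᴴ = T - S := (hT.isHermitian.sub hS.isHermitian).eq
    have h4 : ∀ v, (T - S) *ᵥ v = 0 := by
      intro v
      by_contra hv
      have h5 := hS.inv.dotProduct_mulVec_pos hv
      rw [mulVec_mulVec, star_mulVec, hsym, ← dotProduct_mulVec, mulVec_mulVec, ← mul_assoc, h2] at h5
      simp at h5
    have h6 := congrFun (h4 (Pi.single j 1)) i
    simpa using h6
  rw [sub_eq_zero.1 h3]

lemma exists_posDef_sqrt (hΦ : Φ.PosDef) :
    ∃ T : Matrix (Fin 2) (Fin 2) ℝ, T.PosDef ∧ T * T = Φ ∧ trSqrt Φ = T.trace := by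
  obtain ⟨T, hT, h1, h2⟩ := exists_posSemidef_sqrt hΦ.posSemidef
  refine ⟨T, ?_, h1, h2⟩
  rw [hT.posDef_iff_isUnit]
  have h3 : IsUnit (T * T) := h1 ▸ hΦ.isUnit
  exact isUnit_of_mul_isUnit_left h3

lemma trace_inv_mul_mul_self (hS : S.PosDef) : (S⁻¹ * (S * S)).trace = S.trace := by
  rw [nonsing_inv_mul_cancel_left _ _ ((isUnit_iff_isUnit_det S).1 hS.isUnit)]

end SquareRoot

/-! ### Cauchy–Schwarz and the largest eigenvalue -/

section RealLinearAlgebra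

lemma dotProduct_self_nonneg' {n : Type*} [Fintype n] (v : n → ℝ) : 0 ≤ v ⬝ᵥ v :=
  Finset.sum_nonneg fun i _ => mul_self_nonneg (v i)

lemma dotProduct_sq_le {n : Type*} [Fintype n] (v w : n → ℝ) :
    (v ⬝ᵥ w) ^ 2 ≤ (v ⬝ᵥ v) * (w ⬝ᵥ w) := by
  have := Finset.sum_mul_sq_le_sq_mul_sq Finset.univ v w
  simpa [dotProduct, pow_two] using this

lemma norm_toLp_sq {n : Type*} [Fintype n] (v : n → ℝ) :
    ‖WithLp.toLp 2 v‖ ^ 2 = v ⬝ᵥ v := by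
  rw [EuclideanSpace.norm_sq_eq]
  simp [dotProduct, pow_two]

lemma posSemidef_smul_one_sub_iff {n : Type*} [Fintype n] [DecidableEq n] [Nonempty n]
    {A : Matrix n n ℝ} (hA : A.IsHermitian) (b : ℝ) :
    (b • (1 : Matrix n n ℝ) - A).PosSemidef ↔ sSup (spectrum ℝ A) ≤ b := by
  have hne : (spectrum ℝ A).Nonempty := by
    rw [hA.spectrum_real_eq_range_eigenvalues]
    exact Set.range_nonempty _
  have hherm : (b • (1 : Matrix n n ℝ) - A).IsHermitian := by
    refine IsHermitian.sub ?_ hA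
    simp [IsHermitian]
  rw [posSemidef_iff_isHermitian_and_spectrum_nonneg, csSup_le_iff (Set.Finite.bddAbove
    A.finite_real_spectrum) hne, ← Algebra.algebraMap_eq_smul_one, ← spectrum.singleton_sub_eq]
  rw [← Algebra.algebraMap_eq_smul_one] at hherm
  simp only [hherm, true_and, Set.singleton_sub, Set.image_subset_iff]
  exact forall₂_congr fun x _ => by simp

end RealLinearAlgebra

/-! ### The lift `Φ ↦ Φ̃` and its adjoint -/

section Tilde

variable (X Y : Matrix (Fin 2) (Fin 2) ℝ)

lemma U_mul_mul_transpose : U * X * Uᵀ = !![X 1 1, -X 1 0; -X 0 1, X 0 0] := by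
  ext i j
  fin_cases i <;> fin_cases j <;>
    simp [U, Matrix.mul_apply, Fin.sum_univ_two, -cons_mul]

lemma trace_tilde_mul_tilde_transpose :
    (tilde X * (tilde Y)ᵀ).trace = 2 * (X * Yᵀ).trace := by
  simp [tilde, U_mul_mul_transpose, trace, mul_apply, Fin.sum_univ_two]
  ring

lemma tilde_sub : tilde (X - Y) = tilde X - tilde Y := by
  ext i j
  rcases j with j | j <;> simp [tilde, mul_sub, sub_mul]

lemma tilde_smul (c : ℝ) : tilde (c • X) = c • tilde X := by
  ext i j
  rcases j with j | j <;> simp [tilde]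

lemma tilde_add : tilde (X + Y) = tilde X + tilde Y := by
  ext i j
  rcases j with j | j <;> simp [tilde, mul_add, add_mul]

/-- Explains the shape of `Cmat`: its symmetrized blocks represent, on symmetric matrices, the
linear term of the surrogate. -/
lemma trace_symmetrized_blocks_mul (B : Matrix (Fin 2) (Fin 2 ⊕ Fin 2) ℝ)
    {X : Matrix (Fin 2) (Fin 2) ℝ} (hX : Xᵀ = X) :
    ((B.toCols₁ + B.toCols₁ᵀ + Uᵀ * (B.toCols₂ + B.toCols₂ᵀ) * U) * X).trace
      = 2 * (B * (tilde X)ᵀ).trace := by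
  have h10 : X 1 0 = X 0 1 := congrFun (congrFun hX 0) 1
  simp [tilde, U_mul_mul_transpose, trace, mul_apply, Fin.sum_univ_two, toCols₁, toCols₂, h10]
  simp [U]
  ring

end Tilde

/-! ### The surrogate as a proximal majorizer -/

section Majorizer

variable {m : ℕ} (R₁ R₂ : Matrix (Fin m) (Fin m) ℝ) (J : Matrix (Fin m) (Fin 2) ℝ)
  (Ψ X : Matrix (Fin 2) (Fin 2) ℝ)

/-- The derivative of `∑ ‖Φ̃ aᵢ‖` at `Ψ` in the direction `X`. -/
noncomputable def dirDeriv : ℝ :=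
  ∑ i, (tilde Ψ *ᵥ avec R₁ R₂ J i) ⬝ᵥ (tilde X *ᵥ avec R₁ R₂ J i) / nrm R₁ R₂ J Ψ i

lemma nrm_nonneg (i : Fin m) : 0 ≤ nrm R₁ R₂ J X i := norm_nonneg _

lemma nrm_sq (i : Fin m) : nrm R₁ R₂ J X i ^ 2
    = (tilde X *ᵥ avec R₁ R₂ J i) ⬝ᵥ (tilde X *ᵥ avec R₁ R₂ J i) := norm_toLp_sq _

lemma dotProduct_le_nrm_mul_nrm (i : Fin m) :
    (tilde Ψ *ᵥ avec R₁ R₂ J i) ⬝ᵥ (tilde X *ᵥ avec R₁ R₂ J i)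
      ≤ nrm R₁ R₂ J Ψ i * nrm R₁ R₂ J X i := by
  refine (abs_le_of_sq_le_sq' ?_ (mul_nonneg (nrm_nonneg ..) (nrm_nonneg ..))).2
  rw [mul_pow, nrm_sq, nrm_sq]
  exact dotProduct_sq_le ..

/-- Cauchy–Schwarz termwise. With `dirDeriv_self` this is the subgradient inequality for the sum of
norms, which is positively homogeneous. -/
lemma dirDeriv_le (hΨ : Nonvanishing R₁ R₂ J Ψ) :
    dirDeriv R₁ R₂ J Ψ X ≤ ∑ i, nrm R₁ R₂ J X i := by
  refine Finset.sum_le_sum fun i _ => ?_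
  have hpos : 0 < nrm R₁ R₂ J Ψ i := lt_of_le_of_ne (nrm_nonneg ..) (hΨ i).symm
  rw [div_le_iff₀ hpos, mul_comm]
  exact dotProduct_le_nrm_mul_nrm ..

lemma dirDeriv_self (hΨ : Nonvanishing R₁ R₂ J Ψ) :
    dirDeriv R₁ R₂ J Ψ Ψ = ∑ i, nrm R₁ R₂ J Ψ i := by
  refine Finset.sum_congr rfl fun i _ => ?_
  rw [← nrm_sq, pow_two, mul_div_cancel_right₀ _ (hΨ i)]

lemma trace_mul_Amat_mul_transpose (P Q : Matrix (Fin 2) (Fin 2 ⊕ Fin 2) ℝ) :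
    (P * Amat R₁ R₂ J Ψ * Qᵀ).trace
      = ∑ i, (P *ᵥ avec R₁ R₂ J i) ⬝ᵥ (Q *ᵥ avec R₁ R₂ J i) / nrm R₁ R₂ J Ψ i := by
  rw [Amat, Matrix.mul_sum, Matrix.sum_mul, trace_sum]
  refine Finset.sum_congr rfl fun i _ => ?_
  rw [Matrix.mul_smul, Matrix.smul_mul, trace_smul, mul_vecMulVec, vecMulVec_mul, vecMul_transpose,
    trace_vecMulVec, smul_eq_mul]
  ring

lemma trace_Bmat_mul_tilde_transpose :
    (Bmat R₁ R₂ J Ψ * (tilde X)ᵀ).trace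
      = dirDeriv R₁ R₂ J Ψ X - 2 * lam₁ R₁ R₂ J Ψ * (Ψ * Xᵀ).trace := by
  rw [Bmat, Ashift, Matrix.mul_sub, Matrix.sub_mul, trace_sub, trace_mul_Amat_mul_transpose, Matrix.mul_smul, Matrix.mul_one,
    Matrix.smul_mul, trace_smul, trace_tilde_mul_tilde_transpose, dirDeriv, smul_eq_mul]
  ring

lemma trace_Cmat_mul {X : Matrix (Fin 2) (Fin 2) ℝ} (hX : Xᵀ = X) :
    (Cmat R₁ R₂ J Ψ * X).trace = 2 * dirDeriv R₁ R₂ J Ψ X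
      - 4 * lam₁ R₁ R₂ J Ψ * (Ψ * X).trace - (HRH R₁ R₂ J * X).trace := by
  rw [Cmat, sub_mul, trace_sub, trace_symmetrized_blocks_mul _ hX, trace_Bmat_mul_tilde_transpose,
    hX]
  ring

lemma Amat_isHermitian : (Amat R₁ R₂ J Ψ).IsHermitian := by
  rw [IsHermitian, Amat, conjTranspose_sum]
  refine Finset.sum_congr rfl fun i _ => ?_
  rw [conjTranspose_smul, conjTranspose_vecMulVec]
  simp

lemma dotProduct_Amat_mulVec (v : Fin 2 ⊕ Fin 2 → ℝ) :
    v ⬝ᵥ (Amat R₁ R₂ J Ψ *ᵥ v) = ∑ i, (avec R₁ R₂ J i ⬝ᵥ v) ^ 2 / nrm R₁ R₂ J Ψ i := by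
  rw [Amat, sum_mulVec, dotProduct_sum]
  refine Finset.sum_congr rfl fun i _ => ?_
  rw [smul_mulVec, dotProduct_smul, vecMulVec_mulVec, dotProduct_smul]
  rw [dotProduct_comm v]
  simp
  ring

lemma posSemidef_lam₁_smul_one_sub :
    (lam₁ R₁ R₂ J Ψ • (1 : Matrix (Fin 2 ⊕ Fin 2) (Fin 2 ⊕ Fin 2) ℝ)
      - Amat R₁ R₂ J Ψ).PosSemidef :=
  (posSemidef_smul_one_sub_iff (Amat_isHermitian ..) _).2 le_rfl

lemma dotProduct_Amat_mulVec_le (v : Fin 2 ⊕ Fin 2 → ℝ) :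
    v ⬝ᵥ (Amat R₁ R₂ J Ψ *ᵥ v) ≤ lam₁ R₁ R₂ J Ψ * (v ⬝ᵥ v) := by
  have := (posSemidef_lam₁_smul_one_sub R₁ R₂ J Ψ).dotProduct_mulVec_nonneg v
  simp only [star_trivial, sub_mulVec, smul_mulVec, one_mulVec, dotProduct_sub, dotProduct_smul,
    smul_eq_mul] at this
  linarith

/-- The bound is the trace of `A`. Unlike `lam₁`, its continuity in `Ψ` is evident, which is what
the limit argument needs. -/
lemma lam₁_le : lam₁ R₁ R₂ J Ψ
    ≤ ∑ i, (avec R₁ R₂ J i ⬝ᵥ avec R₁ R₂ J i) / nrm R₁ R₂ J Ψ i := by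
  refine (posSemidef_smul_one_sub_iff (Amat_isHermitian ..) _).1
    (PosSemidef.of_dotProduct_mulVec_nonneg ?_ fun v => ?_)
  · refine IsHermitian.sub ?_ (Amat_isHermitian ..)
    simp [IsHermitian]
  · simp only [star_trivial, sub_mulVec, smul_mulVec, one_mulVec, dotProduct_sub, dotProduct_smul,
      smul_eq_mul, dotProduct_Amat_mulVec, Finset.sum_mul, ← Finset.sum_sub_distrib]
    refine Finset.sum_nonneg fun i _ => ?_
    rw [div_mul_eq_mul_div, ← sub_div]
    exact div_nonneg (sub_nonneg.2 (dotProduct_sq_le ..)) (nrm_nonneg ..)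

lemma lam₁_pos (hm : 0 < m) (hΨ : Nonvanishing R₁ R₂ J Ψ) : 0 < lam₁ R₁ R₂ J Ψ := by
  set a := avec R₁ R₂ J ⟨0, hm⟩ with ha
  have ha0 : 0 < a ⬝ᵥ a := by
    refine lt_of_le_of_ne (dotProduct_self_nonneg' a) fun h0 => hΨ ⟨0, hm⟩ ?_
    rw [nrm, ← ha, dotProduct_self_eq_zero.1 h0.symm]
    simp
  have hle := dotProduct_Amat_mulVec_le R₁ R₂ J Ψ a
  have hpos : 0 < a ⬝ᵥ (Amat R₁ R₂ J Ψ *ᵥ a) := by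
    rw [dotProduct_Amat_mulVec]
    refine Finset.sum_pos' (fun i _ => div_nonneg (sq_nonneg _) (nrm_nonneg ..))
      ⟨⟨0, hm⟩, Finset.mem_univ _, ?_⟩
    rw [← ha]
    exact div_pos (pow_pos ha0 2) (lt_of_le_of_ne (nrm_nonneg ..) (hΨ _).symm)
  exact pos_of_mul_pos_left (hpos.trans_le hle) ha0.le

lemma trace_tilde_mul_Amat_le :
    (tilde X * Amat R₁ R₂ J Ψ * (tilde X)ᵀ).trace ≤ 2 * lam₁ R₁ R₂ J Ψ * (X * Xᵀ).trace := by
  have h1 := ((posSemidef_lam₁_smul_one_sub R₁ R₂ J Ψ).mul_mul_conjTranspose_same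
    (tilde X)).trace_nonneg
  rw [conjTranspose_eq_transpose_of_trivial, Matrix.mul_sub, Matrix.sub_mul, trace_sub, Matrix.mul_smul,
    Matrix.mul_one, Matrix.smul_mul, trace_smul, trace_tilde_mul_tilde_transpose, smul_eq_mul] at h1
  linarith

lemma surrogate_eq (hΨs : Ψᵀ = Ψ) (hΨ : Nonvanishing R₁ R₂ J Ψ)
    {X : Matrix (Fin 2) (Fin 2) ℝ} (hX : Xᵀ = X) :
    surrogate R₁ R₂ J Ψ X = 2 * dirDeriv R₁ R₂ J Ψ X
      + 2 * lam₁ R₁ R₂ J Ψ * ((X - Ψ) * (X - Ψ)).trace - (HRH R₁ R₂ J * X).trace - trSqrt X := by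
  have h1 := trace_Bmat_mul_tilde_transpose R₁ R₂ J Ψ Ψ
  have h2 := trace_Bmat_mul_tilde_transpose R₁ R₂ J Ψ X
  rw [Bmat] at h1 h2
  rw [surrogate, h1, h2, dirDeriv_self _ _ _ _ hΨ, trace_mul_comm _ (tilde X),
    trace_tilde_mul_tilde_transpose, hΨs, hX, Matrix.mul_sub, Matrix.sub_mul, Matrix.sub_mul, trace_sub, trace_sub,
    trace_sub, trace_mul_comm X Ψ]
  ring

lemma surrogate_self (hΨs : Ψᵀ = Ψ) (hΨ : Nonvanishing R₁ R₂ J Ψ) :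
    surrogate R₁ R₂ J Ψ Ψ = h R₁ R₂ J Ψ := by
  rw [surrogate_eq _ _ _ _ hΨs hΨ hΨs, dirDeriv_self _ _ _ _ hΨ, h]
  simp

lemma h_le_surrogate (hΨs : Ψᵀ = Ψ) (hΨ : Nonvanishing R₁ R₂ J Ψ)
    {X : Matrix (Fin 2) (Fin 2) ℝ} (hX : Xᵀ = X) :
    h R₁ R₂ J X ≤ surrogate R₁ R₂ J Ψ X := by
  have h1 := trace_tilde_mul_Amat_le R₁ R₂ J Ψ (X - Ψ)
  rw [trace_mul_Amat_mul_transpose, transpose_sub, hΨs, hX] at h1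
  have h2 : 2 * ∑ i, nrm R₁ R₂ J X i ≤ 2 * dirDeriv R₁ R₂ J Ψ X
      + ∑ i, (tilde (X - Ψ) *ᵥ avec R₁ R₂ J i) ⬝ᵥ (tilde (X - Ψ) *ᵥ avec R₁ R₂ J i)
        / nrm R₁ R₂ J Ψ i := by
    rw [dirDeriv, Finset.mul_sum, Finset.mul_sum, ← Finset.sum_add_distrib]
    refine Finset.sum_le_sum fun i _ => ?_
    have hpos : 0 < nrm R₁ R₂ J Ψ i := lt_of_le_of_ne (nrm_nonneg ..) (hΨ i).symm
    rw [mul_div_assoc', ← add_div, le_div_iff₀ hpos, tilde_sub, sub_mulVec, sub_dotProduct,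
      dotProduct_sub, dotProduct_sub, ← nrm_sq, ← nrm_sq,
      dotProduct_comm (tilde X *ᵥ _) (tilde Ψ *ᵥ _)]
    -- After clearing the denominator this is `2 p q ≤ p² + q²` for the two norms.
    nlinarith [sq_nonneg (nrm R₁ R₂ J X i - nrm R₁ R₂ J Ψ i)]
  rw [surrogate_eq _ _ _ _ hΨs hΨ hX, h]
  linarith

end Majorizer

/-! ### The closed-form update -/

section Update

variable {m : ℕ} {R₁ R₂ : Matrix (Fin m) (Fin m) ℝ} {J : Matrix (Fin m) (Fin 2) ℝ}
  {Ψ Ψ' X : Matrix (Fin 2) (Fin 2) ℝ}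

lemma transpose_eq_of_posSemidef {n : Type*} {X : Matrix n n ℝ} (hX : X.PosSemidef) : Xᵀ = X := by
  rw [← conjTranspose_eq_transpose_of_trivial, hX.isHermitian.eq]

lemma transpose_mul_self_of_mem_orthogonalGroup {V : Matrix (Fin 2) (Fin 2) ℝ}
    (hV : V ∈ orthogonalGroup (Fin 2) ℝ) : Vᵀ * V = 1 := by
  simpa [star_eq_conjTranspose] using (mem_orthogonalGroup_iff' (Fin 2) ℝ).1 hV

lemma mul_transpose_self_of_mem_orthogonalGroup {V : Matrix (Fin 2) (Fin 2) ℝ}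
    (hV : V ∈ orthogonalGroup (Fin 2) ℝ) : V * Vᵀ = 1 := by
  simpa [star_eq_conjTranspose] using (mem_orthogonalGroup_iff (Fin 2) ℝ).1 hV

lemma conj_diagonal_mul_conj_diagonal {V : Matrix (Fin 2) (Fin 2) ℝ}
    (hV : V ∈ orthogonalGroup (Fin 2) ℝ) (x y : Fin 2 → ℝ) :
    V * diagonal x * Vᵀ * (V * diagonal y * Vᵀ) = V * diagonal (fun i => x i * y i) * Vᵀ := by
  rw [← diagonal_mul_diagonal]
  simp only [Matrix.mul_assoc]
  rw [← Matrix.mul_assoc Vᵀ V, transpose_mul_self_of_mem_orthogonalGroup hV, Matrix.one_mul]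

lemma posSemidef_conj_diagonal (V : Matrix (Fin 2) (Fin 2) ℝ) {x : Fin 2 → ℝ}
    (hx : ∀ i, 0 ≤ x i) : (V * diagonal x * Vᵀ).PosSemidef :=
  (PosSemidef.diagonal (d := x) hx).mul_mul_conjTranspose_same V

lemma posDef_conj_diagonal {V : Matrix (Fin 2) (Fin 2) ℝ} (hV : V ∈ orthogonalGroup (Fin 2) ℝ)
    {x : Fin 2 → ℝ} (hx : ∀ i, 0 < x i) : (V * diagonal x * Vᵀ).PosDef := by
  rw [(posSemidef_conj_diagonal V fun i => (hx i).le).posDef_iff_isUnit]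
  refine IsUnit.of_mul_eq_one (V * diagonal (fun i => (x i)⁻¹) * Vᵀ) ?_
  rw [conj_diagonal_mul_conj_diagonal hV]
  simp [(hx _).ne', mul_transpose_self_of_mem_orthogonalGroup hV]

lemma inv_conj_diagonal {V : Matrix (Fin 2) (Fin 2) ℝ} (hV : V ∈ orthogonalGroup (Fin 2) ℝ)
    {x : Fin 2 → ℝ} (hx : ∀ i, 0 < x i) :
    (V * diagonal x * Vᵀ)⁻¹ = V * diagonal (fun i => (x i)⁻¹) * Vᵀ := by
  refine inv_eq_right_inv ?_
  rw [conj_diagonal_mul_conj_diagonal hV]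
  simp [(hx _).ne', mul_transpose_self_of_mem_orthogonalGroup hV]

/-- The stationarity equation of an update, tested against symmetric matrices. -/
lemma IsUpdate.exists_conj_diagonal (hu : IsUpdate R₁ R₂ J Ψ Ψ') :
    ∃ V ∈ orthogonalGroup (Fin 2) ℝ, ∃ x : Fin 2 → ℝ, (∀ i, 0 < x i) ∧
      Ψ' = V * diagonal (fun i => x i ^ 2) * Vᵀ ∧
      ∀ X : Matrix (Fin 2) (Fin 2) ℝ, Xᵀ = X →
        (V * diagonal (fun i => (x i)⁻¹) * Vᵀ * X).trace / 2
          = 2 * dirDeriv R₁ R₂ J Ψ X - (HRH R₁ R₂ J * X).trace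
            + 4 * lam₁ R₁ R₂ J Ψ * ((Ψ' - Ψ) * X).trace := by
  obtain ⟨V, hV, E, x, hC, hx, hΨ'⟩ := hu
  refine ⟨V, hV, x, fun i => (hx i).1, hΨ', fun X hX => ?_⟩
  -- The cubic divided by `x i`.
  have hdiag : diagonal (fun i => (x i)⁻¹)
      = (2 : ℝ) • diagonal E + (8 * lam₁ R₁ R₂ J Ψ) • diagonal (fun i => x i ^ 2) := by
    rw [← diagonal_smul, ← diagonal_smul, diagonal_add]
    congr 1
    ext i
    have h1 := (hx i).1.ne'
    have h2 := (hx i).2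
    simp only [Pi.smul_apply, smul_eq_mul]
    field_simp
    linarith
  have hmat : V * diagonal (fun i => (x i)⁻¹) * Vᵀ
      = (2 : ℝ) • Cmat R₁ R₂ J Ψ + (8 * lam₁ R₁ R₂ J Ψ) • Ψ' := by
    rw [hdiag, hC, hΨ', Matrix.mul_add, Matrix.add_mul]
    simp only [Matrix.mul_smul, Matrix.smul_mul]
  rw [hmat, Matrix.add_mul, trace_add, Matrix.smul_mul, Matrix.smul_mul, trace_smul, trace_smul,
    trace_Cmat_mul _ _ _ _ hX, Matrix.sub_mul, trace_sub, smul_eq_mul, smul_eq_mul]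
  ring

lemma IsUpdate.exists_posDef_sqrt (hu : IsUpdate R₁ R₂ J Ψ Ψ') :
    ∃ S : Matrix (Fin 2) (Fin 2) ℝ, S.PosDef ∧ Ψ' = S * S ∧
      ∀ X : Matrix (Fin 2) (Fin 2) ℝ, Xᵀ = X →
        (S⁻¹ * X).trace / 2
          = 2 * dirDeriv R₁ R₂ J Ψ X - (HRH R₁ R₂ J * X).trace
            + 4 * lam₁ R₁ R₂ J Ψ * ((Ψ' - Ψ) * X).trace := by
  obtain ⟨V, hV, x, hx, hΨ', H⟩ := hu.exists_conj_diagonal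
  refine ⟨V * diagonal x * Vᵀ, posDef_conj_diagonal hV hx, ?_, ?_⟩
  · rw [hΨ', conj_diagonal_mul_conj_diagonal hV]
    simp only [pow_two]
  · rwa [inv_conj_diagonal hV hx]

lemma IsUpdate.posDef (hu : IsUpdate R₁ R₂ J Ψ Ψ') : Ψ'.PosDef := by
  obtain ⟨V, hV, x, hx, rfl, -⟩ := hu.exists_conj_diagonal
  exact posDef_conj_diagonal hV fun i => pow_pos (hx i) 2

/-- The quadratic part expands exactly around `Ψ'`, and stationarity, tested against `X` and `Ψ'`,
turns its linear part into the tangent of `trSqrt` at `Ψ'`. -/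
lemma surrogate_sub_surrogate (hΨs : Ψᵀ = Ψ) (hΨ : Nonvanishing R₁ R₂ J Ψ)
    {S : Matrix (Fin 2) (Fin 2) ℝ} (hS : S.PosDef) (hΨ' : Ψ' = S * S)
    (H : ∀ X : Matrix (Fin 2) (Fin 2) ℝ, Xᵀ = X →
      (S⁻¹ * X).trace / 2 = 2 * dirDeriv R₁ R₂ J Ψ X - (HRH R₁ R₂ J * X).trace
        + 4 * lam₁ R₁ R₂ J Ψ * ((Ψ' - Ψ) * X).trace) (hX : Xᵀ = X) :
    surrogate R₁ R₂ J Ψ X - surrogate R₁ R₂ J Ψ Ψ'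
      = 2 * lam₁ R₁ R₂ J Ψ * ((X - Ψ') * (X - Ψ')).trace
        + (S.trace / 2 + (S⁻¹ * X).trace / 2 - trSqrt X) := by
  have hSs : Sᵀ = S := transpose_eq_of_posSemidef hS.posSemidef
  have hΨ's : Ψ'ᵀ = Ψ' := by rw [hΨ', transpose_mul, hSs]
  have h1 := H X hX
  have h2 := H Ψ' hΨ's
  have h3 : (S⁻¹ * Ψ').trace = S.trace := by rw [hΨ', trace_inv_mul_mul_self hS]
  have h4 : trSqrt Ψ' = S.trace := by rw [hΨ', trSqrt_mul_self hS.posSemidef]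
  rw [surrogate_eq _ _ _ _ hΨs hΨ hX, surrogate_eq _ _ _ _ hΨs hΨ hΨ's, h4]
  rw [h3] at h2
  simp only [Matrix.mul_sub, Matrix.sub_mul, trace_sub] at h1 h2 ⊢
  rw [trace_mul_comm X Ψ, trace_mul_comm X Ψ']
  rw [trace_mul_comm Ψ' Ψ] at *
  linear_combination -h1 + h2

lemma trace_mul_self_nonneg (hX : Xᵀ = X) : 0 ≤ (X * X).trace := by
  have := (posSemidef_conjTranspose_mul_self X).trace_nonneg
  rwa [conjTranspose_eq_transpose_of_trivial, hX] at this

lemma IsUpdate.isMinOn (hm : 0 < m) (hΨs : Ψᵀ = Ψ) (hΨ : Nonvanishing R₁ R₂ J Ψ)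
    (hu : IsUpdate R₁ R₂ J Ψ Ψ') : IsMinOn (surrogate R₁ R₂ J Ψ) psd Ψ' := by
  obtain ⟨S, hS, hΨ', H⟩ := hu.exists_posDef_sqrt
  intro X hX
  have hXs := transpose_eq_of_posSemidef hX
  have h1 := surrogate_sub_surrogate hΨs hΨ hS hΨ' H hXs
  have h2 := trSqrt_le_tangent hS hX
  have h3 : 0 ≤ ((X - Ψ') * (X - Ψ')).trace := trace_mul_self_nonneg (by
    rw [transpose_sub, hXs, transpose_eq_of_posSemidef hu.posDef.posSemidef])
  have h4 := mul_nonneg (lam₁_pos R₁ R₂ J Ψ hm hΨ).le h3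
  show surrogate R₁ R₂ J Ψ Ψ' ≤ surrogate R₁ R₂ J Ψ X
  linarith

lemma exists_pos_root {c : ℝ} (hc : 0 < c) (e : ℝ) :
    ∃ x : ℝ, 0 < x ∧ 4 * (2 * c) * x ^ 3 + 2 * e * x - 1 = 0 := by
  set p : ℝ → ℝ := fun x => 4 * (2 * c) * x ^ 3 + 2 * e * x - 1 with hp
  -- Chosen so that `b ≥ 1` and `8 c b ≥ 1 + 2 |e|`, making the cubic term dominate at `b`.
  set b : ℝ := 1 + (1 + 2 * |e|) / (8 * c) with hb
  have hq : 0 ≤ (1 + 2 * |e|) / (8 * c) := by positivity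
  have hb1 : 1 ≤ b := by linarith
  have hcb : 8 * c * b = 8 * c + (1 + 2 * |e|) := by
    rw [hb]
    field_simp
  have hpb : 0 ≤ p b := by
    have h1 : 1 + 2 * |e| ≤ 8 * c * b := by linarith
    have h2 : (1 + 2 * |e|) * b ≤ 8 * c * b ^ 3 := by
      have : (1 + 2 * |e|) * b ≤ 8 * c * b * b := mul_le_mul_of_nonneg_right h1 (by linarith)
      have h3 : 0 ≤ 8 * c * b * b * (b - 1) :=
        mul_nonneg (by positivity) (by linarith)
      nlinarith
    have h4 : -|e| * b ≤ e * b := mul_le_mul_of_nonneg_right (neg_abs_le e) (by linarith)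
    simp only [hp]
    nlinarith
  have hcont : ContinuousOn p (Set.Icc 0 b) := by fun_prop
  obtain ⟨x, hx, hx0⟩ := intermediate_value_Icc (by linarith) hcont
    (show (0 : ℝ) ∈ Set.Icc (p 0) (p b) from ⟨by simp [hp], hpb⟩)
  refine ⟨x, lt_of_le_of_ne hx.1 fun h0 => ?_, hx0⟩
  rw [← h0] at hx0
  simp [hp] at hx0

lemma Cmat_isHermitian (hH : (HRH R₁ R₂ J).IsHermitian) : (Cmat R₁ R₂ J Ψ).IsHermitian := by
  rw [IsHermitian, conjTranspose_eq_transpose_of_trivial] at hH ⊢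
  simp only [Cmat, transpose_sub, transpose_add, transpose_mul, transpose_transpose, hH,
    Matrix.mul_assoc]
  rw [add_comm (Bmat R₁ R₂ J Ψ).toCols₁ᵀ, add_comm (Bmat R₁ R₂ J Ψ).toCols₂ᵀ]

lemma exists_isUpdate (hm : 0 < m) (hH : (HRH R₁ R₂ J).IsHermitian)
    (hΨ : Nonvanishing R₁ R₂ J Ψ) : ∃ Ψ', IsUpdate R₁ R₂ J Ψ Ψ' := by
  have hC : (Cmat R₁ R₂ J Ψ).IsHermitian := Cmat_isHermitian hH
  choose x hx using fun i => exists_pos_root (lam₁_pos R₁ R₂ J Ψ hm hΨ) (hC.eigenvalues i)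
  refine ⟨_, hC.eigenvectorUnitary, hC.eigenvectorUnitary.2, hC.eigenvalues, x, ?_, hx, rfl⟩
  conv_lhs => rw [hC.spectral_theorem]
  rfl

end Update

/-! ### A spectral floor preserved by updates -/

section LowerBound

variable {m : ℕ} {R₁ R₂ : Matrix (Fin m) (Fin m) ℝ} {J : Matrix (Fin m) (Fin 2) ℝ}
  {Ψ Ψ' X : Matrix (Fin 2) (Fin 2) ℝ}

lemma nrm_sq_le (i : Fin m) : nrm R₁ R₂ J X i ^ 2
    ≤ 2 * (avec R₁ R₂ J i ⬝ᵥ avec R₁ R₂ J i) * (X * Xᵀ).trace := by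
  have h1 : (2 : ℝ) * (X * Xᵀ).trace = ∑ r, tilde X r ⬝ᵥ tilde X r := by
    rw [← trace_tilde_mul_tilde_transpose]
    rfl
  rw [nrm_sq, mul_right_comm, h1, Finset.sum_mul]
  refine Finset.sum_le_sum fun r _ => ?_
  have := dotProduct_sq_le (tilde X r) (avec R₁ R₂ J i)
  rwa [pow_two] at this

lemma trace_mul_vecMulVec_self (A : Matrix (Fin 2) (Fin 2) ℝ) (v : Fin 2 → ℝ) :
    (A * vecMulVec v v).trace = v ⬝ᵥ (A *ᵥ v) := by
  rw [mul_vecMulVec, trace_vecMulVec, dotProduct_comm]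

/-- The bound does not depend on `Ψ`, so one threshold serves all iterates. -/
lemma dirDeriv_vecMulVec_self_le (hΨ : Nonvanishing R₁ R₂ J Ψ) {v : Fin 2 → ℝ}
    (hv : v ⬝ᵥ v = 1) : dirDeriv R₁ R₂ J Ψ (vecMulVec v v)
      ≤ ∑ i, Real.sqrt (2 * (avec R₁ R₂ J i ⬝ᵥ avec R₁ R₂ J i)) := by
  refine (dirDeriv_le _ _ _ _ _ hΨ).trans (Finset.sum_le_sum fun i _ => Real.le_sqrt_of_sq_le ?_)
  refine (nrm_sq_le i).trans_eq ?_
  rw [transpose_vecMulVec, trace_mul_vecMulVec_self, vecMulVec_mulVec, hv]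
  simp [hv]

/-- An update does not push the spectrum below a small threshold. -/
lemma IsUpdate.posSemidef_sub_smul_one (hm : 0 < m) (hH : (HRH R₁ R₂ J).PosSemidef)
    (hΨ : Nonvanishing R₁ R₂ J Ψ) (hu : IsUpdate R₁ R₂ J Ψ Ψ') {s : ℝ} (hs : 0 < s)
    (hsc : 4 * s * ∑ i, Real.sqrt (2 * (avec R₁ R₂ J i ⬝ᵥ avec R₁ R₂ J i)) < 1)
    (hle : (Ψ - s ^ 2 • (1 : Matrix (Fin 2) (Fin 2) ℝ)).PosSemidef) :
    (Ψ' - s ^ 2 • (1 : Matrix (Fin 2) (Fin 2) ℝ)).PosSemidef := by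
  obtain ⟨V, hV, x, hx, hΨ', H⟩ := hu.exists_conj_diagonal
  have hVV := transpose_mul_self_of_mem_orthogonalGroup hV
  have hdiag : ∀ (y : Fin 2 → ℝ) i,
      (V *ᵥ Pi.single i 1) ⬝ᵥ ((V * diagonal y * Vᵀ) *ᵥ (V *ᵥ Pi.single i 1)) = y i := by
    intro y i
    rw [mulVec_mulVec, Matrix.mul_assoc, hVV, Matrix.mul_one, ← mulVec_mulVec,
      dotProduct_mulVec, ← mulVec_transpose, mulVec_mulVec, hVV]
    simp
  have hxs : ∀ i, s ≤ x i := by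
    intro i
    by_contra! hlt
    set v := V *ᵥ Pi.single i 1 with hv
    have hv1 : v ⬝ᵥ v = 1 := by
      have := hdiag (fun _ => 1) i
      rwa [diagonal_one, Matrix.mul_one, mul_transpose_self_of_mem_orthogonalGroup hV,
        one_mulVec] at this
    have h1 := H (vecMulVec v v) (transpose_vecMulVec v v)
    rw [trace_mul_vecMulVec_self, trace_mul_vecMulVec_self, trace_mul_vecMulVec_self, hdiag,
      sub_mulVec, dotProduct_sub, hΨ', hdiag] at h1
    have h2 := dirDeriv_vecMulVec_self_le hΨ hv1
    have h3 := hH.dotProduct_mulVec_nonneg v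
    have h4 := hle.dotProduct_mulVec_nonneg v
    simp only [star_trivial, sub_mulVec, smul_mulVec, one_mulVec, dotProduct_sub, dotProduct_smul,
      smul_eq_mul, hv1] at h3 h4
    have h5 : x i ^ 2 < s ^ 2 := by
      have := hx i
      gcongr
    -- An eigenvalue of `Ψ'` below the floor lies below the Rayleigh quotient of `Ψ`, so the
    -- proximal term has the sign that helps.
    have h6 : 4 * lam₁ R₁ R₂ J Ψ * (x i ^ 2 - v ⬝ᵥ (Ψ *ᵥ v)) ≤ 0 :=
      mul_nonpos_of_nonneg_of_nonpos (by linarith [lam₁_pos R₁ R₂ J Ψ hm hΨ]) (by linarith)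
    set c := ∑ i, Real.sqrt (2 * (avec R₁ R₂ J i ⬝ᵥ avec R₁ R₂ J i)) with hc
    have h7 : (x i)⁻¹ ≤ 4 * c := by linarith
    have h8 : s⁻¹ < (x i)⁻¹ := by
      have := hx i
      gcongr
    have h9 : 1 < s * (4 * c) := by
      rw [← mul_inv_cancel₀ hs.ne']
      exact mul_lt_mul_of_pos_left (h8.trans_le h7) hs
    linarith
  have h1 : Ψ' - s ^ 2 • (1 : Matrix (Fin 2) (Fin 2) ℝ)
      = V * diagonal (fun i => x i ^ 2 - s ^ 2) * Vᵀ := by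
    rw [← diagonal_sub, Matrix.mul_sub, Matrix.sub_mul, ← hΨ']
    congr 1
    rw [← smul_one_eq_diagonal, Matrix.mul_smul, Matrix.smul_mul, Matrix.mul_one,
      mul_transpose_self_of_mem_orthogonalGroup hV]
  rw [h1]
  exact posSemidef_conj_diagonal V fun i =>
    sub_nonneg.2 (pow_le_pow_left₀ hs.le (hxs i) 2)

end LowerBound

/-! ### Positivity of the information matrix -/

section Information

variable {m : ℕ} {R₁ R₂ : Matrix (Fin m) (Fin m) ℝ} {J : Matrix (Fin m) (Fin 2) ℝ}
  {X : Matrix (Fin 2) (Fin 2) ℝ}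

lemma HRH_eq : HRH R₁ R₂ J = Jᵀ * R₁ * J + (J * U)ᵀ * R₂ * (J * U) := by
  rw [HRH, Hmat, transpose_fromRows, fromCols_mul_fromBlocks, fromCols_mul_fromRows]
  simp

/-- A unit row of `J` and its rotation by `U` form an orthonormal basis of the plane. -/
lemma mulVec_eq_zero_of_orientation (hm : 0 < m) (hJ : IsOrientation J) {v : Fin 2 → ℝ}
    (h1 : J *ᵥ v = 0) (h2 : (J * U) *ᵥ v = 0) : v = 0 := by
  have e0 := hJ ⟨0, hm⟩
  have e1 := congrFun h1 ⟨0, hm⟩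
  have e2 := congrFun h2 ⟨0, hm⟩
  rw [← mulVec_mulVec] at e2
  simp [mulVec, dotProduct, U, Fin.sum_univ_two] at e0 e1 e2
  set a := J ⟨0, hm⟩ 0
  set b := J ⟨0, hm⟩ 1
  ext i
  fin_cases i
  · simp only [Fin.zero_eta, Fin.isValue, Pi.zero_apply]
    linear_combination (-v 0) * e0 + a * e1 - b * e2
  · simp only [Fin.mk_one, Fin.isValue, Pi.zero_apply]
    linear_combination (-v 1) * e0 + b * e1 + a * e2

lemma HRH_posDef (hm : 0 < m) (hJ : IsOrientation J) (h₁ : R₁.PosDef) (h₂ : R₂.PosDef) :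
    (HRH R₁ R₂ J).PosDef := by
  rw [HRH_eq]
  have p1 := h₁.posSemidef.conjTranspose_mul_mul_same J
  have p2 := h₂.posSemidef.conjTranspose_mul_mul_same (J * U)
  rw [conjTranspose_eq_transpose_of_trivial] at p1 p2
  have key : ∀ (R : Matrix (Fin m) (Fin m) ℝ) (K : Matrix (Fin m) (Fin 2) ℝ) (v : Fin 2 → ℝ),
      v ⬝ᵥ ((Kᵀ * R * K) *ᵥ v) = (K *ᵥ v) ⬝ᵥ (R *ᵥ (K *ᵥ v)) := by
    intro R K v
    rw [← mulVec_mulVec, ← mulVec_mulVec, dotProduct_mulVec, vecMul_transpose]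
  refine PosDef.of_dotProduct_mulVec_pos (p1.add p2).isHermitian fun v hv => ?_
  rw [star_trivial, add_mulVec, dotProduct_add, key, key]
  by_cases hJv : J *ᵥ v = 0
  · have hJUv : (J * U) *ᵥ v ≠ 0 := fun h => hv (mulVec_eq_zero_of_orientation hm hJ hJv h)
    have h5 := h₁.posSemidef.dotProduct_mulVec_nonneg (J *ᵥ v)
    have h6 := h₂.dotProduct_mulVec_pos hJUv
    rw [star_trivial] at h5 h6
    linarith
  · have h5 := h₂.posSemidef.dotProduct_mulVec_nonneg ((J * U) *ᵥ v)
    have h6 := h₁.dotProduct_mulVec_pos hJv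
    rw [star_trivial] at h5 h6
    linarith

lemma trace_HRH_mul_eq_sum :
    (HRH R₁ R₂ J * X).trace = ∑ i, J i ⬝ᵥ (tilde X *ᵥ avec R₁ R₂ J i) := by
  have key : ∀ (K : Matrix (Fin 2) (Fin m) ℝ) (Y : Matrix (Fin 2) (Fin 2) ℝ),
      ∑ i, J i ⬝ᵥ (Y *ᵥ fun r => K r i) = (K * J * Y).trace := by
    intro K Y
    rw [Matrix.mul_assoc, trace_mul_comm, Matrix.mul_assoc]
    rfl
  simp only [tilde, avec, fromCols_mulVec_sumElim, dotProduct_add, Finset.sum_add_distrib]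
  rw [key, key, HRH_eq, Matrix.add_mul, trace_add, transpose_mul]
  congr 1
  simp only [← Matrix.mul_assoc]
  rw [trace_mul_comm _ Uᵀ]
  simp only [← Matrix.mul_assoc]

lemma trace_HRH_mul_le (hJ : IsOrientation J) :
    (HRH R₁ R₂ J * X).trace ≤ ∑ i, nrm R₁ R₂ J X i := by
  rw [trace_HRH_mul_eq_sum]
  refine Finset.sum_le_sum fun i _ => ?_
  refine (abs_le_of_sq_le_sq' ?_ (nrm_nonneg ..)).2
  have := dotProduct_sq_le (J i) (tilde X *ᵥ avec R₁ R₂ J i)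
  rwa [hJ i, one_mul, ← nrm_sq] at this

end Information

/-! ### Positive definite `2 × 2` matrices and compactness -/

section PosDef

variable {M X : Matrix (Fin 2) (Fin 2) ℝ}

lemma exists_posSemidef_sub_smul_one (hM : M.PosDef) :
    ∃ c : ℝ, 0 < c ∧ ∀ c' ≤ c, (M - c' • (1 : Matrix (Fin 2) (Fin 2) ℝ)).PosSemidef := by
  have hH := hM.isHermitian
  obtain ⟨i, hi⟩ := Finite.exists_min hH.eigenvalues
  refine ⟨hH.eigenvalues i, hM.eigenvalues_pos i, fun c hc => ?_⟩
  set V : Matrix (Fin 2) (Fin 2) ℝ := ↑hH.eigenvectorUnitary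
  have hMV : M = V * diagonal hH.eigenvalues * Vᵀ := by
    conv_lhs => rw [hH.spectral_theorem]
    rfl
  have h1 : M - c • (1 : Matrix (Fin 2) (Fin 2) ℝ)
      = V * diagonal (fun i => hH.eigenvalues i - c) * Vᵀ := by
    rw [← diagonal_sub, Matrix.mul_sub, Matrix.sub_mul, ← hMV]
    congr 1
    rw [← smul_one_eq_diagonal, Matrix.mul_smul, Matrix.smul_mul, Matrix.mul_one,
      mul_transpose_self_of_mem_orthogonalGroup hH.eigenvectorUnitary.2]
  rw [h1]
  exact posSemidef_conj_diagonal V fun j => sub_nonneg.2 (hc.trans (hi j))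

lemma posDef_of_posSemidef_sub_smul_one {c : ℝ} (hc : 0 < c)
    (hX : (X - c • (1 : Matrix (Fin 2) (Fin 2) ℝ)).PosSemidef) : X.PosDef := by
  have := PosDef.posSemidef_add hX (PosDef.one.smul hc)
  rwa [sub_add_cancel] at this

lemma trace_mul_nonneg (hM : M.PosSemidef) (hX : X.PosSemidef) : 0 ≤ (M * X).trace := by
  obtain ⟨T, hT, rfl, -⟩ := exists_posSemidef_sqrt hX
  have := (hM.conjTranspose_mul_mul_same T).trace_nonneg
  rwa [hT.isHermitian.eq, Matrix.mul_assoc, trace_mul_comm, Matrix.mul_assoc] at this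

lemma abs_apply_le_trace (hX : X.PosSemidef) (i j : Fin 2) : |X i j| ≤ X.trace := by
  have h0 := hX.diag_nonneg (i := 0)
  have h1 := hX.diag_nonneg (i := 1)
  have hd := hX.det_nonneg
  have hs : X 1 0 = X 0 1 := congrFun (congrFun (transpose_eq_of_posSemidef hX) 0) 1
  rw [det_fin_two, hs] at hd
  have h01 : |X 0 1| ≤ X 0 0 + X 1 1 := abs_le_of_sq_le_sq (by nlinarith) (by linarith)
  rw [trace_fin_two]
  fin_cases i <;> fin_cases j <;> simp only [Fin.zero_eta, Fin.mk_one, Fin.isValue]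
  · rw [abs_of_nonneg h0]; linarith
  · exact h01
  · rw [hs]; exact h01
  · rw [abs_of_nonneg h1]; linarith

lemma two_mul_trace_mul_le {A B : Matrix (Fin 2) (Fin 2) ℝ} (hA : Aᵀ = A) (hB : Bᵀ = B) {t : ℝ}
    (ht : 0 < t) : 2 * (A * B).trace ≤ 1 / t * (A * A).trace + t * (B * B).trace := by
  have h1 : 0 ≤ ((t • B - A) * (t • B - A)).trace :=
    trace_mul_self_nonneg (by rw [transpose_sub, transpose_smul, hA, hB])
  simp only [Matrix.mul_sub, Matrix.sub_mul, trace_sub, Matrix.smul_mul, Matrix.mul_smul,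
    trace_smul, smul_eq_mul] at h1
  rw [trace_mul_comm B A] at h1
  refine le_of_mul_le_mul_left ?_ ht
  have h2 : t * (1 / t * (A * A).trace + t * (B * B).trace)
      = (A * A).trace + t * (t * (B * B).trace) := by
    field_simp
  rw [h2]
  linarith

lemma isClosed_setOf_posSemidef : IsClosed {X : Matrix (Fin 2) (Fin 2) ℝ | X.PosSemidef} := by
  simp only [posSemidef_iff_dotProduct_mulVec, Set.ofPred_and, Set.ofPred_forall]
  refine IsClosed.inter (isClosed_eq (by fun_prop) continuous_id) (isClosed_iInter fun v => ?_)
  exact isClosed_le continuous_const (by fun_prop)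

lemma isCompact_setOf_abs_apply_le (B : ℝ) :
    IsCompact {X : Matrix (Fin 2) (Fin 2) ℝ | ∀ i j, |X i j| ≤ B} := by
  have h1 : IsCompact (Set.univ.pi fun _ : Fin 2 => Set.univ.pi fun _ : Fin 2 => Set.Icc (-B) B) :=
    isCompact_univ_pi fun _ => isCompact_univ_pi fun _ => isCompact_Icc
  have h2 : {X : Matrix (Fin 2) (Fin 2) ℝ | ∀ i j, |X i j| ≤ B}
      = Set.univ.pi fun _ : Fin 2 => Set.univ.pi fun _ : Fin 2 => Set.Icc (-B) B := by
    refine Set.ext fun X => ?_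
    simp only [Set.mem_ofPred_eq, abs_le]
    exact ⟨fun H i _ j _ => H i j, fun H i j => H i trivial j trivial⟩
  rw [h2]
  exact h1

end PosDef

/-! ### Coercivity, descent and uniqueness of the minimizer -/

section Objective

variable {m : ℕ} {R₁ R₂ : Matrix (Fin m) (Fin m) ℝ} {J : Matrix (Fin m) (Fin 2) ℝ}
  {Ψ Ψ' X : Matrix (Fin 2) (Fin 2) ℝ}

/-- One of the two copies of the sum of norms absorbs the trace term, leaving at least `Tr (Hᵀ R H
X) - Tr √X`. -/
lemma exists_coercive (hJ : IsOrientation J) (hH : (HRH R₁ R₂ J).PosDef) :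
    ∃ c : ℝ, 0 < c ∧ ∀ X : Matrix (Fin 2) (Fin 2) ℝ, X.PosSemidef →
      c / 2 * X.trace - 1 / c ≤ h R₁ R₂ J X := by
  obtain ⟨c, hc, H⟩ := exists_posSemidef_sub_smul_one hH
  refine ⟨c, hc, fun X hX => ?_⟩
  have h1 := trace_mul_nonneg (H c le_rfl) hX
  rw [Matrix.sub_mul, trace_sub, Matrix.smul_mul, trace_smul, Matrix.one_mul, smul_eq_mul] at h1
  have h2 := trace_HRH_mul_le (R₁ := R₁) (R₂ := R₂) (X := X) hJ
  -- The tangent at scale `c⁻¹` costs `c / 2 * X.trace`, half of the available growth, plus the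
  -- constant `1 / c`.
  have hS : (c⁻¹ • (1 : Matrix (Fin 2) (Fin 2) ℝ)).PosDef := PosDef.one.smul (inv_pos.2 hc)
  have h3 := trSqrt_le_tangent hS hX
  have h4 : (c⁻¹ • (1 : Matrix (Fin 2) (Fin 2) ℝ))⁻¹ = c • (1 : Matrix (Fin 2) (Fin 2) ℝ) := by
    refine inv_eq_right_inv ?_
    rw [Matrix.smul_mul, Matrix.mul_smul, smul_smul, inv_mul_cancel₀ hc.ne', one_smul,
      Matrix.one_mul]
  rw [h4, Matrix.smul_mul, trace_smul, trace_smul, Matrix.one_mul, trace_one, smul_eq_mul,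
    smul_eq_mul, Fintype.card_fin] at h3
  push_cast at h3
  rw [h, one_div]
  linarith

lemma IsUpdate.h_le (hm : 0 < m) (hΨp : Ψ.PosSemidef) (hΨ : Nonvanishing R₁ R₂ J Ψ)
    (hu : IsUpdate R₁ R₂ J Ψ Ψ') : h R₁ R₂ J Ψ' ≤ h R₁ R₂ J Ψ := by
  have hΨs := transpose_eq_of_posSemidef hΨp
  calc h R₁ R₂ J Ψ' ≤ surrogate R₁ R₂ J Ψ Ψ' :=
        h_le_surrogate _ _ _ _ hΨs hΨ (transpose_eq_of_posSemidef hu.posDef.posSemidef)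
    _ ≤ surrogate R₁ R₂ J Ψ Ψ := hu.isMinOn hm hΨs hΨ hΨp
    _ = h R₁ R₂ J Ψ := surrogate_self _ _ _ _ hΨs hΨ

/-- Convexity and the stationarity of the update bound the objective from below in terms of
the decrease achieved by the update. -/
lemma IsUpdate.sub_le_h (hm : 0 < m) (hΨp : Ψ.PosSemidef) (hΨ : Nonvanishing R₁ R₂ J Ψ)
    (hu : IsUpdate R₁ R₂ J Ψ Ψ') (hX : X.PosSemidef) {t : ℝ} (ht : 0 < t) :
    h R₁ R₂ J Ψ - (1 + 1 / t) * (h R₁ R₂ J Ψ - h R₁ R₂ J Ψ')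
      - 2 * lam₁ R₁ R₂ J Ψ * t * ((X - Ψ) * (X - Ψ)).trace ≤ h R₁ R₂ J X := by
  have hΨs := transpose_eq_of_posSemidef hΨp
  have hΨ's := transpose_eq_of_posSemidef hu.posDef.posSemidef
  have hXs := transpose_eq_of_posSemidef hX
  have hlam := lam₁_pos R₁ R₂ J Ψ hm hΨ
  obtain ⟨S, hS, hΨ', H⟩ := hu.exists_posDef_sqrt
  have hgap := surrogate_sub_surrogate hΨs hΨ hS hΨ' H hΨs
  have hmaj := h_le_surrogate R₁ R₂ J Ψ hΨs hΨ hΨ's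
  rw [surrogate_self _ _ _ _ hΨs hΨ] at hgap
  have hβ := trSqrt_le_tangent hS hΨp
  have hΔ : 0 ≤ ((Ψ - Ψ') * (Ψ - Ψ')).trace :=
    trace_mul_self_nonneg (by rw [transpose_sub, hΨs, hΨ's])
  have hdX := dirDeriv_le R₁ R₂ J Ψ X hΨ
  have hdΨ := dirDeriv_self R₁ R₂ J Ψ hΨ
  have hSX := H X hXs
  have hSΨ := H Ψ hΨs
  have htan := trSqrt_le_tangent hS hX
  have hamgm := two_mul_trace_mul_le (A := Ψ' - Ψ) (B := X - Ψ)
    (by rw [transpose_sub, hΨs, hΨ's]) (by rw [transpose_sub, hΨs, hXs]) ht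
  have hneg : ((Ψ' - Ψ) * (Ψ' - Ψ)).trace = ((Ψ - Ψ') * (Ψ - Ψ')).trace := by
    rw [← neg_sub Ψ Ψ', Matrix.neg_mul, Matrix.mul_neg, neg_neg]
  rw [hneg] at hamgm
  -- Subgradient of the norms at `Ψ`, tangent of `trSqrt` at `S * S`, and stationarity tested
  -- against `X` and `Ψ`.
  have hlin : h R₁ R₂ J X ≥ h R₁ R₂ J Ψ
      - 4 * lam₁ R₁ R₂ J Ψ * ((Ψ' - Ψ) * (X - Ψ)).trace
      - (S.trace / 2 + (S⁻¹ * Ψ).trace / 2 - trSqrt Ψ) := by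
    rw [Matrix.mul_sub, trace_sub, h, h]
    linarith
  set Δ := ((Ψ - Ψ') * (Ψ - Ψ')).trace
  set Q := ((X - Ψ) * (X - Ψ)).trace
  set l := lam₁ R₁ R₂ J Ψ
  have h5 : 2 * l * (2 * ((Ψ' - Ψ) * (X - Ψ)).trace) ≤ 2 * l * (1 / t * Δ + t * Q) :=
    mul_le_mul_of_nonneg_left hamgm (by linarith)
  -- The decrease of `h` pays for both the squared step and the tangent gap at `Ψ`.
  have h6 : 2 * l * Δ ≤ h R₁ R₂ J Ψ - h R₁ R₂ J Ψ' := by linarith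
  have h7 : 1 / t * (2 * l * Δ) ≤ 1 / t * (h R₁ R₂ J Ψ - h R₁ R₂ J Ψ') :=
    mul_le_mul_of_nonneg_left h6 (by positivity)
  have h8 : 0 ≤ l * Δ := mul_nonneg hlam.le hΔ
  linarith

lemma continuous_nrm (i : Fin m) : Continuous fun X => nrm R₁ R₂ J X i := by
  have h1 : (fun X => nrm R₁ R₂ J X i) = fun X => Real.sqrt
      ((tilde X *ᵥ avec R₁ R₂ J i) ⬝ᵥ (tilde X *ᵥ avec R₁ R₂ J i)) := by
    ext X
    rw [← nrm_sq, Real.sqrt_sq (nrm_nonneg ..)]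
  rw [h1]
  have h2 : Continuous tilde := by
    refine continuous_matrix fun i j => ?_
    rcases j with j | j
    · simp only [tilde, fromCols_apply_inl]
      fun_prop
    · simp only [tilde, fromCols_apply_inr]
      fun_prop
  fun_prop

lemma nrm_smul_add_le (Y : Matrix (Fin 2) (Fin 2) ℝ) (i : Fin m) :
    nrm R₁ R₂ J ((1 / 2 : ℝ) • (X + Y)) i ≤ (nrm R₁ R₂ J X i + nrm R₁ R₂ J Y i) / 2 := by
  simp only [nrm, tilde_smul, tilde_add, smul_mulVec, add_mulVec, WithLp.toLp_smul, WithLp.toLp_add,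
    norm_smul]
  rw [Real.norm_of_nonneg (by norm_num)]
  linarith [norm_add_le (WithLp.toLp 2 (tilde X *ᵥ avec R₁ R₂ J i))
    (WithLp.toLp 2 (tilde Y *ᵥ avec R₁ R₂ J i))]

/-- At the midpoint the norms are convex and the tangent of `trSqrt` averages exactly, so two
minimizers must both attain equality in that tangent bound. -/
lemma eq_of_isMinOn (hΨ : Ψ.PosDef) (hΨ' : Ψ'.PosDef) (h₁ : IsMinOn (h R₁ R₂ J) psd Ψ)
    (h₂ : IsMinOn (h R₁ R₂ J) psd Ψ') : Ψ = Ψ' := by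
  set P := (1 / 2 : ℝ) • (Ψ + Ψ') with hP
  have hPd : P.PosDef := (hΨ.add hΨ').smul (by norm_num)
  obtain ⟨S, hS, hSS, hST⟩ := exists_posDef_sqrt hPd
  have e1 : h R₁ R₂ J Ψ ≤ h R₁ R₂ J P := h₁ hPd.posSemidef
  have e2 : h R₁ R₂ J Ψ' ≤ h R₁ R₂ J P := h₂ hPd.posSemidef
  have t1 := trSqrt_le_tangent hS hΨ.posSemidef
  have t2 := trSqrt_le_tangent hS hΨ'.posSemidef
  have t3 : (S⁻¹ * P).trace = S.trace := by rw [← hSS, trace_inv_mul_mul_self hS]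
  have n1 : ∑ i, nrm R₁ R₂ J P i
      ≤ (∑ i, nrm R₁ R₂ J Ψ i + ∑ i, nrm R₁ R₂ J Ψ' i) / 2 := by
    rw [← Finset.sum_add_distrib, Finset.sum_div]
    exact Finset.sum_le_sum fun i _ => nrm_smul_add_le ..
  have q1 : (HRH R₁ R₂ J * P).trace
      = ((HRH R₁ R₂ J * Ψ).trace + (HRH R₁ R₂ J * Ψ').trace) / 2 := by
    rw [hP, Matrix.mul_smul, trace_smul, Matrix.mul_add, trace_add, smul_eq_mul]
    ring
  have q2 : (S⁻¹ * P).trace = ((S⁻¹ * Ψ).trace + (S⁻¹ * Ψ').trace) / 2 := by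
    rw [hP, Matrix.mul_smul, trace_smul, Matrix.mul_add, trace_add, smul_eq_mul]
    ring
  rw [h, h] at e1 e2
  have s1 := eq_mul_self_of_trSqrt_eq_tangent hS hΨ.posSemidef (by linarith)
  have s2 := eq_mul_self_of_trSqrt_eq_tangent hS hΨ'.posSemidef (by linarith)
  rw [s1, s2]

end Objective

/-! ### Positive definiteness of the weights -/

section Weights

variable {m : ℕ} {d : Fin m → ℝ}

lemma posDef_distMat_mul_mul_distMat (hd : ∀ i, 0 < d i) {S : Matrix (Fin m) (Fin m) ℝ}
    (hS : S.PosDef) : (distMat d * S⁻¹ * distMat d).PosDef := by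
  have hD : (distMat d).PosDef := PosDef.diagonal fun i => one_div_pos.2 (hd i)
  have := hS.inv.conjTranspose_mul_mul_same (mulVec_injective_of_isUnit hD.isUnit)
  rwa [hD.isHermitian.eq] at this

lemma R₁_posDef (hd : ∀ i, 0 < d i) {Stoa Srss : Matrix (Fin m) (Fin m) ℝ} (htoa : Stoa.PosDef)
    (hrss : Srss.PosDef) (η : ℝ) : (R₁ Stoa Srss η d).PosDef :=
  htoa.inv.add_posSemidef
    ((posDef_distMat_mul_mul_distMat hd hrss).posSemidef.smul (sq_nonneg η))

end Weights

/-! ### Convergence of the iterates -/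

section Convergence

variable {m : ℕ} {R₁ R₂ : Matrix (Fin m) (Fin m) ℝ} {J : Matrix (Fin m) (Fin 2) ℝ}
  {Φ : ℕ → Matrix (Fin 2) (Fin 2) ℝ}

lemma exists_posSemidef_sub_smul_one_of_isUpdate (hm : 0 < m) (hH : (HRH R₁ R₂ J).PosDef)
    (hu : ∀ k, IsUpdate R₁ R₂ J (Φ k) (Φ (k + 1))) (hN : ∀ k, Nonvanishing R₁ R₂ J (Φ k)) :
    ∃ c : ℝ, 0 < c ∧
      ∀ k, (Φ (k + 1) - c • (1 : Matrix (Fin 2) (Fin 2) ℝ)).PosSemidef := by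
  obtain ⟨c, hc, hcle⟩ := exists_posSemidef_sub_smul_one (hu 0).posDef
  set r := ∑ i, Real.sqrt (2 * (avec R₁ R₂ J i ⬝ᵥ avec R₁ R₂ J i)) with hr
  have hr0 : 0 ≤ r := Finset.sum_nonneg fun i _ => Real.sqrt_nonneg _
  -- The first entry puts the floor below the spectrum of `Φ 1`; the second gives `4 * s * r < 1`.
  set s := min (Real.sqrt c) (1 / (4 * r + 1)) with hs
  have hs0 : 0 < s := lt_min (Real.sqrt_pos.2 hc) (by positivity)
  have hsc : s ^ 2 ≤ c := by
    calc s ^ 2 ≤ Real.sqrt c ^ 2 := pow_le_pow_left₀ hs0.le (min_le_left _ _) 2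
      _ = c := Real.sq_sqrt hc.le
  have hsr : 4 * s * r < 1 := by
    have h1 : s * (4 * r + 1) ≤ 1 := (le_div_iff₀ (by positivity)).1 (min_le_right _ _)
    linarith
  refine ⟨s ^ 2, pow_pos hs0 2, fun k => ?_⟩
  induction k with
  | zero => exact hcle _ hsc
  | succ k ih =>
    exact (hu (k + 1)).posSemidef_sub_smul_one hm hH.posSemidef (hN (k + 1)) hs0 hsr ih

/-- A nondegenerate positive definite cluster point of the iterates minimizes the objective,
whose values converge to the minimum. -/
lemma isMinOn_of_mapClusterPt (hm : 0 < m) (hΦ : ∀ k, (Φ k).PosSemidef)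
    (hu : ∀ k, IsUpdate R₁ R₂ J (Φ k) (Φ (k + 1))) (hN : ∀ k, Nonvanishing R₁ R₂ J (Φ k))
    {l : ℝ} (hl : Tendsto (fun k => h R₁ R₂ J (Φ k)) atTop (𝓝 l))
    {Ψ : Matrix (Fin 2) (Fin 2) ℝ} (hΨ : Ψ.PosDef) (hc : MapClusterPt Ψ atTop Φ)
    (hΨN : Nonvanishing R₁ R₂ J Ψ) : IsMinOn (h R₁ R₂ J) psd Ψ ∧ h R₁ R₂ J Ψ = l := by
  obtain ⟨F, hF, hFΨ⟩ := mapClusterPt_iff_ultrafilter.1 hc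
  have hlF := hl.mono_left hF
  have hlF' := (hl.comp (tendsto_add_atTop_nat 1)).mono_left hF
  have hnrm : ∀ i, Tendsto (fun k => nrm R₁ R₂ J (Φ k) i) F (𝓝 (nrm R₁ R₂ J Ψ i)) := fun i =>
    ((continuous_nrm i).tendsto Ψ).comp hFΨ
  have hlower : ∀ X : Matrix (Fin 2) (Fin 2) ℝ, X.PosSemidef → l ≤ h R₁ R₂ J X := by
    intro X hX
    set b : Matrix (Fin 2) (Fin 2) ℝ → ℝ := fun Y =>
      ∑ i, (avec R₁ R₂ J i ⬝ᵥ avec R₁ R₂ J i) / nrm R₁ R₂ J Y i with hb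
    set q : Matrix (Fin 2) (Fin 2) ℝ → ℝ := fun Y => ((X - Y) * (X - Y)).trace with hq
    have hbF : Tendsto (fun k => b (Φ k)) F (𝓝 (b Ψ)) :=
      tendsto_finsetSum _ fun i _ => tendsto_const_nhds.div (hnrm i) (hΨN i)
    have hqc : Continuous q := by
      simp only [hq]
      fun_prop
    have hqF : Tendsto (fun k => q (Φ k)) F (𝓝 (q Ψ)) := (hqc.tendsto Ψ).comp hFΨ
    have hstep : ∀ t : ℝ, 0 < t → l - 2 * b Ψ * t * q Ψ ≤ h R₁ R₂ J X := by
      intro t ht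
      have hlim : Tendsto (fun k => h R₁ R₂ J (Φ k)
          - (1 + 1 / t) * (h R₁ R₂ J (Φ k) - h R₁ R₂ J (Φ (k + 1)))
          - 2 * b (Φ k) * t * q (Φ k)) F
          (𝓝 (l - (1 + 1 / t) * (l - l) - 2 * b Ψ * t * q Ψ)) :=
        (hlF.sub ((hlF.sub hlF').const_mul _)).sub
          (((hbF.const_mul 2).mul_const t).mul hqF)
      rw [sub_self, mul_zero, sub_zero] at hlim
      refine le_of_tendsto' hlim fun k => ?_
      have h1 := (hu k).sub_le_h hm (hΦ k) (hN k) hX ht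
      have h2 : 0 ≤ q (Φ k) := trace_mul_self_nonneg (by
        rw [transpose_sub, transpose_eq_of_posSemidef hX, transpose_eq_of_posSemidef (hΦ k)])
      have h3 : lam₁ R₁ R₂ J (Φ k) * (t * q (Φ k)) ≤ b (Φ k) * (t * q (Φ k)) :=
        mul_le_mul_of_nonneg_right (lam₁_le ..) (mul_nonneg ht.le h2)
      linarith
    -- The order of limits matters: `k` goes to infinity at fixed `t`, which removes the `1 / t`
    -- term, and only then does `t` tend to zero.
    have hzero : Tendsto (fun t : ℝ => l - 2 * b Ψ * t * q Ψ) (𝓝[>] 0) (𝓝 l) := by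
      have hcont : Continuous fun t : ℝ => l - 2 * b Ψ * t * q Ψ := by fun_prop
      have := hcont.tendsto 0
      simp only [mul_zero, zero_mul, sub_zero] at this
      exact this.mono_left nhdsWithin_le_nhds
    exact le_of_tendsto hzero (eventually_nhdsWithin_of_forall hstep)
  have hupper : h R₁ R₂ J Ψ ≤ l := by
    obtain ⟨T, hT, hTT, hTr⟩ := exists_posDef_sqrt hΨ
    -- Replacing `trSqrt` by its tangent at `Ψ` gives a continuous minorant of `h` on the cone,
    -- exact at `Ψ`; continuity of `trSqrt` is not needed.
    set p : Matrix (Fin 2) (Fin 2) ℝ → ℝ := fun Y => 2 * ∑ i, nrm R₁ R₂ J Y i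
      - (HRH R₁ R₂ J * Y).trace - (T.trace / 2 + (T⁻¹ * Y).trace / 2) with hp
    have hpc : Continuous p := by
      have := fun i => continuous_nrm (R₁ := R₁) (R₂ := R₂) (J := J) i
      simp only [hp]
      fun_prop
    have hpΨ : p Ψ = h R₁ R₂ J Ψ := by
      have : (T⁻¹ * Ψ).trace = T.trace := by rw [← hTT, trace_inv_mul_mul_self hT]
      simp only [hp, h, hTr, this]
      ring
    rw [← hpΨ]
    refine le_of_tendsto_of_tendsto' ((hpc.tendsto Ψ).comp hFΨ) hlF fun k => ?_
    have := trSqrt_le_tangent hT (hΦ k)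
    simp only [hp, Function.comp_apply, h]
    linarith
  have heq : h R₁ R₂ J Ψ = l := le_antisymm hupper (hlower Ψ hΨ.posSemidef)
  exact ⟨fun X hX => heq.trans_le (hlower X hX), heq⟩

lemma exists_tendsto_isMinOn (hm : 0 < m) (hJ : IsOrientation J) (hH : (HRH R₁ R₂ J).PosDef)
    (hΦ0 : (Φ 0).PosSemidef) (hu : ∀ k, IsUpdate R₁ R₂ J (Φ k) (Φ (k + 1)))
    (hN : ∀ k, Nonvanishing R₁ R₂ J (Φ k))
    (hcl : ∀ Ψ : Matrix (Fin 2) (Fin 2) ℝ, Ψ.PosDef → MapClusterPt Ψ atTop Φ →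
      Nonvanishing R₁ R₂ J Ψ) :
    ∃ Φstar : Matrix (Fin 2) (Fin 2) ℝ, Φstar.PosSemidef ∧ IsMinOn (h R₁ R₂ J) psd Φstar ∧
      Tendsto Φ atTop (𝓝 Φstar) ∧
      Tendsto (fun k => h R₁ R₂ J (Φ k)) atTop (𝓝 (h R₁ R₂ J Φstar)) := by
  have hΦ : ∀ k, (Φ k).PosSemidef
    | 0 => hΦ0
    | k + 1 => (hu k).posDef.posSemidef
  have hanti : Antitone fun k => h R₁ R₂ J (Φ k) :=
    antitone_nat_of_succ_le fun k => (hu k).h_le hm (hΦ k) (hN k)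
  obtain ⟨c, hc, hcoer⟩ := exists_coercive hJ hH
  have hbdd : BddBelow (Set.range fun k => h R₁ R₂ J (Φ k)) := by
    refine ⟨-(1 / c), ?_⟩
    rintro _ ⟨k, rfl⟩
    have h1 := hcoer _ (hΦ k)
    have h2 := mul_nonneg (half_pos hc).le (hΦ k).trace_nonneg
    linarith
  have hl := tendsto_atTop_ciInf hanti hbdd
  set B := (h R₁ R₂ J (Φ 0) + 1 / c) / (c / 2) with hB
  have hbound : ∀ k i j, |Φ k i j| ≤ B := by
    intro k i j
    refine (abs_apply_le_trace (hΦ k) i j).trans ?_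
    rw [hB, le_div_iff₀ (half_pos hc)]
    have h1 := hcoer _ (hΦ k)
    have h2 := hanti (Nat.zero_le k)
    simp only at h2
    linarith
  have hK := isCompact_setOf_abs_apply_le B
  obtain ⟨ε, hε, hfloor⟩ := exists_posSemidef_sub_smul_one_of_isUpdate hm hH hu hN
  have hpd : ∀ Ψ, MapClusterPt Ψ atTop Φ → Ψ.PosDef := by
    intro Ψ hΨ
    refine posDef_of_posSemidef_sub_smul_one hε ?_
    obtain ⟨F, hF, hFΨ⟩ := mapClusterPt_iff_ultrafilter.1 hΨ
    refine isClosed_setOf_posSemidef.mem_of_tendsto (hFΨ.sub_const _)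
      -- The index starts at `1` because `Φ 0` may be singular.
      (hF (eventually_atTop.2 ⟨1, fun k hk => ?_⟩))
    obtain ⟨j, rfl⟩ := Nat.exists_eq_add_of_le' hk
    exact hfloor j
  have hmin : ∀ Ψ, MapClusterPt Ψ atTop Φ →
      IsMinOn (h R₁ R₂ J) psd Ψ ∧ h R₁ R₂ J Ψ = ⨅ k, h R₁ R₂ J (Φ k) := fun Ψ hΨ =>
    isMinOn_of_mapClusterPt hm hΦ hu hN hl (hpd Ψ hΨ) hΨ (hcl Ψ (hpd Ψ hΨ) hΨ)
  obtain ⟨Ψ, -, hΨ⟩ := hK.exists_mapClusterPt_of_frequently (l := atTop) (f := Φ)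
    (Frequently.of_forall hbound)
  refine ⟨Ψ, (hpd Ψ hΨ).posSemidef, (hmin Ψ hΨ).1, ?_, ?_⟩
  · exact hK.tendsto_nhds_of_unique_mapClusterPt (Eventually.of_forall hbound) fun Y _ hY =>
      eq_of_isMinOn (hpd Y hY) (hpd Ψ hΨ) (hmin Y hY).1 (hmin Ψ hΨ).1
  · rw [(hmin Ψ hΨ).2]
    exact hl

end Convergence

end SensorPlacement

theorem lemma9 (m : ℕ) (hm : 0 < m)
    (Stoa Srss Saoa : Matrix (Fin m) (Fin m) ℝ)
    (htoa : Stoa.PosDef) (hrss : Srss.PosDef) (haoa : Saoa.PosDef)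
    (η : ℝ) (d : Fin m → ℝ) (hd : ∀ i, 0 < d i)
    (J : Matrix (Fin m) (Fin 2) ℝ) (hJ : SensorPlacement.IsOrientation J)
    (R₁ R₂ : Matrix (Fin m) (Fin m) ℝ)
    (hR₁ : R₁ = SensorPlacement.R₁ Stoa Srss η d) (hR₂ : R₂ = SensorPlacement.R₂ Saoa d) :
    -- the inner loop is an MM method whose closed-form update minimizes the surrogate
    (∀ Ψ : Matrix (Fin 2) (Fin 2) ℝ, Ψ.PosSemidef → SensorPlacement.Nonvanishing R₁ R₂ J Ψ →
      (∀ X : Matrix (Fin 2) (Fin 2) ℝ, X.PosSemidef →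
        SensorPlacement.h R₁ R₂ J X ≤ SensorPlacement.surrogate R₁ R₂ J Ψ X) ∧
      SensorPlacement.surrogate R₁ R₂ J Ψ Ψ = SensorPlacement.h R₁ R₂ J Ψ ∧
      (∃ Ψ', SensorPlacement.IsUpdate R₁ R₂ J Ψ Ψ') ∧
      ∀ Ψ', SensorPlacement.IsUpdate R₁ R₂ J Ψ Ψ' → Ψ'.PosSemidef ∧
        IsMinOn (SensorPlacement.surrogate R₁ R₂ J Ψ) SensorPlacement.psd Ψ') ∧
    -- its iterates converge to the global minimum of the dual problem
    (∀ Φ : ℕ → Matrix (Fin 2) (Fin 2) ℝ, (Φ 0).PosSemidef →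
      (∀ k, SensorPlacement.IsUpdate R₁ R₂ J (Φ k) (Φ (k + 1))) →
      (∀ k, SensorPlacement.Nonvanishing R₁ R₂ J (Φ k)) →
      (∀ Ψ : Matrix (Fin 2) (Fin 2) ℝ, Ψ.PosDef → MapClusterPt Ψ Filter.atTop Φ →
        SensorPlacement.Nonvanishing R₁ R₂ J Ψ) →
      ∃ Φstar : Matrix (Fin 2) (Fin 2) ℝ, Φstar.PosSemidef ∧
        IsMinOn (SensorPlacement.h R₁ R₂ J) SensorPlacement.psd Φstar ∧
        Filter.Tendsto Φ Filter.atTop (nhds Φstar) ∧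
        Filter.Tendsto (fun k => SensorPlacement.h R₁ R₂ J (Φ k)) Filter.atTop
          (nhds (SensorPlacement.h R₁ R₂ J Φstar))) := by
  have hR₁p : R₁.PosDef := hR₁ ▸ SensorPlacement.R₁_posDef hd htoa hrss η
  have hR₂p : R₂.PosDef := hR₂ ▸ SensorPlacement.posDef_distMat_mul_mul_distMat hd haoa
  have hH := SensorPlacement.HRH_posDef hm hJ hR₁p hR₂p
  refine ⟨fun Ψ hΨ hN => ?_, fun Φ h0 hu hN hcl =>
    SensorPlacement.exists_tendsto_isMinOn hm hJ hH h0 hu hN hcl⟩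
  have hΨs := SensorPlacement.transpose_eq_of_posSemidef hΨ
  exact ⟨fun X hX => SensorPlacement.h_le_surrogate _ _ _ _ hΨs hN
      (SensorPlacement.transpose_eq_of_posSemidef hX),
    SensorPlacement.surrogate_self _ _ _ _ hΨs hN,
    SensorPlacement.exists_isUpdate hm hH.isHermitian hN,
    fun Ψ' hu => ⟨hu.posDef.posSemidef, hu.isMinOn hm hΨs hN⟩⟩
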